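/- Let $0<q<1$, let $v>-1$ be real, and let $a=q^N$ with $N\in\mathbb Z$. Put $\mathbb R_q^+=\{q^n: n\in\mathbb Z\}$ and $[0,a]_q=\{aq^n: n=0,1,2,\dots\}$, and write $$\int_0^a f(x)\,d_qx=(1-q)a\sum_{n=0}^\infty q^nf(aq^n),\qquad \int_0^\infty f(x)\,d_qx=(1-q)\sum_{n=-\infty}^\infty q^nf(q^n).$$ With $(z;q)_n=\prod_{i=0}^{n-1}(1-zq^i)$, let $$j_v(z,q)=\sum_{n=0}^\infty(-1)^n\frac{q^{n(n+1)/2}}{(q;q)_n(q^{v+1};q)_n}z^{2n},\qquad c_{q,v}=\frac1{1-q}\,\frac{(q^{2v+2};q^2)_\infty}{(q^2;q^2)_\infty}.$$ Let $\mathcal L_{q,v,a}$ be the Hilbert space of real functions $f$ on $[0,a]_q$ with $\int_0^a|f(x)|^2x^{2v+1}d_qx<\infty$, with inner product $\int_0^a f(x)g(x)x^{2v+1}d_qx$, and let $$T_a^vu(x)=c_{q,v}\int_0^a u(t)\,j_v(xt,q^2)\,t^{2v+1}d_qt .$$ Let $(u_i)_{i\in\mathbb N}$ be an orthogonal basis of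 $\mathcal L_{q,v,a}$ consisting of eigenfunctions of $T_a^v$, $T_a^vu_i=\lambda_iu_i$ on $[0,a]_q$. Extend each $u_i$ to all real arguments by $u_i(x)=\frac1{\lambda_i}T_a^vu_i(x)$, and let $\psi_i=u_i/\|u_i\|_{q,2,v}$ be the extended function normalized in the norm $\|f\|_{q,2,v}=\left(\int_0^\infty|f(x)|^2x^{2v+1}d_qx\right)^{1/2}$ (the $q$-prolate spheroidal wave functions). Then for all $i,j\in\mathbb N$ both of the following $q$-integrals converge absolutely, and $$\int_0^a\psi_i(x)\psi_j(x)x^{2v+1}d_qx=\lambda_i\lambda_j\delta_{ij},\qquad \int_0^\infty\psi_i(x)\psi_j(x)x^{2v+1}d_qx=\delta_{ij}.$$ So the $\psi_i$ are orthogonal both on $[0,a]_q$ and on $\mathbb R_q^+$. -/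

import Mathlib

noncomputable section

namespace QProlate

/-- The positive `q`-lattice `ℝ_q^+ = {q ^ n : n ∈ ℤ}`. -/
def lattice (q : ℝ) : Set ℝ := {x | ∃ n : ℤ, x = q ^ n}

/-- The bounded `q`-interval `[0, a]_q = {a q ^ n : n ∈ ℕ}`; for `a = q ^ N` this is
`{q ^ s : s ∈ ℤ, N ≤ s}`. -/
def interval (q a : ℝ) : Set ℝ := {x | ∃ n : ℕ, x = a * q ^ n}

/-- The finite `q`-shifted factorial `(z; q)_n`. -/
def qPoch (z q : ℝ) (n : ℕ) : ℝ := ∏ i ∈ Finset.range n, (1 - z * q ^ i)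

/-- The infinite `q`-shifted factorial `(z; q)_∞`. -/
def qPochInf (z q : ℝ) : ℝ := ∏' i : ℕ, (1 - z * q ^ i)

/-- Jackson's `q`-integral of `f` over `[0, a]`. -/
def jackson (q a : ℝ) (f : ℝ → ℝ) : ℝ := (1 - q) * a * ∑' n : ℕ, q ^ n * f (a * q ^ n)

/-- Convergence of the series that defines Jackson's `q`-integral over `[0, a]`. -/
def JacksonIntegrable (q a : ℝ) (f : ℝ → ℝ) : Prop :=
  Summable fun n : ℕ => q ^ n * f (a * q ^ n)

/-- Jackson's `q`-integral of `f` over `[0, ∞)`. -/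
def jacksonTop (q : ℝ) (f : ℝ → ℝ) : ℝ := (1 - q) * ∑' n : ℤ, q ^ n * f (q ^ n)

/-- Convergence of the series that defines Jackson's `q`-integral over `[0, ∞)`. -/
def JacksonTopIntegrable (q : ℝ) (f : ℝ → ℝ) : Prop :=
  Summable fun n : ℤ => q ^ n * f (q ^ n)

/-- The normalized Hahn-Exton `q`-Bessel function `j_v(z, q)` of order `v`. -/
def hahnExton (v z q : ℝ) : ℝ :=
  ∑' n : ℕ, (-1) ^ n * (q ^ (n * (n + 1) / 2) / (qPoch q q n * qPoch (q ^ (v + 1)) q n)) *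
    z ^ (2 * n)

/-- The constant `c_{q,v}` of the `q`-Bessel Fourier transform. -/
def cConst (q v : ℝ) : ℝ :=
  1 / (1 - q) * (qPochInf (q ^ (2 * v + 2)) (q ^ 2) / qPochInf (q ^ 2) (q ^ 2))

/-- The finite `q`-Bessel Fourier transform
`(T_a^v u)(x) = c_{q,v} ∫_0^a u(t) j_v(x t, q²) t ^ (2v+1) d_q t`. -/
def finiteTransform (q v a : ℝ) (u : ℝ → ℝ) (x : ℝ) : ℝ :=
  cConst q v * jackson q a fun t => u t * hahnExton v (x * t) (q ^ 2) * t ^ (2 * v + 1)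

/-- Membership in the Hilbert space `L_{q,v,a}` of functions on `[0, a]_q` (only the values of `f`
on `[0, a]_q` matter): `∫_0^a |f(x)|² x ^ (2v+1) d_q x < ∞`. -/
def MemL2 (q v a : ℝ) (f : ℝ → ℝ) : Prop :=
  JacksonIntegrable q a fun x => |f x| ^ 2 * x ^ (2 * v + 1)

/-- `(u i)` is an orthogonal basis of `L_{q,v,a}` that consists of eigenfunctions of `T_a^v`, with
eigenvalues `lam i`. Orthogonality is only demanded inside each eigenspace, where it is a matter
of choice; between different eigenspaces it is left to be proved. -/
structure IsEigenbasis (q v a : ℝ) (u : ℕ → ℝ → ℝ) (lam : ℕ → ℝ) : Prop where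
  memL2 : ∀ i, MemL2 q v a (u i)
  ne_zero : ∀ i, ∃ x ∈ interval q a, u i x ≠ 0
  eigen : ∀ i, ∀ x ∈ interval q a, finiteTransform q v a (u i) x = lam i * u i x
  orthogonal : ∀ i j, i ≠ j → lam i = lam j →
    jackson q a (fun x => u i x * u j x * x ^ (2 * v + 1)) = 0
  complete : ∀ w : ℝ → ℝ, MemL2 q v a w →
    (∀ i, jackson q a (fun x => w x * u i x * x ^ (2 * v + 1)) = 0) → ∀ x ∈ interval q a, w x = 0

/-- The extension of an eigenfunction `u` of `T_a^v` with eigenvalue `μ` from `[0, a]_q` to all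
real arguments, through `u(x) = (1 / μ) (T_a^v u)(x)`. -/
def extension (q v a μ : ℝ) (u : ℝ → ℝ) (x : ℝ) : ℝ := 1 / μ * finiteTransform q v a u x

/-- The norm `‖f‖_{q,2,v} = (∫_0^∞ |f(x)|² x ^ (2v+1) d_q x) ^ (1/2)`. -/
def norm2 (q v : ℝ) (f : ℝ → ℝ) : ℝ :=
  √(jacksonTop q fun x => |f x| ^ 2 * x ^ (2 * v + 1))

/-- The `q`-prolate spheroidal wave function of an eigenfunction `u` of `T_a^v` with eigenvalue
`μ`: its extension, scaled to unit norm over the whole positive lattice. -/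
def prolate (q v a μ : ℝ) (u : ℝ → ℝ) (x : ℝ) : ℝ :=
  extension q v a μ u x / norm2 q v (extension q v a μ u)

end QProlate

end

noncomputable section

namespace QProlate

open Filter Topology Finset

/-! ### The two `q`-exponential series -/

/-! The map `f ↦ (q^(n(v+1)) f(q^n))` turns the weighted `L²` space on the lattice into `ℓ²(ℤ)`, up
to the factor `1 - q`. The `q`-Bessel transform becomes a Hankel operator `U` with kernel `k(n +
m)`, because `j_v(xt, q²)` only sees the product `xt`.

The kernel `k` is the correlation of the coefficients of the two `q`-exponentials
(`besselKernel_eq`). These series are inverse to each other, so the rows of `k` are orthonormal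
(`tsum_correlation_mul_correlation`) and `U` is a self-adjoint isometry (`exists_hankel_isometry`).

Let `f_i` be `u_i` cut off to `[0, a]_q`. Then `U f_i = λ_i f_i` on the interval, and the extension
of `u_i` is `U f_i / λ_i`. Hence extensions have inner product `⟨f_i, f_j⟩` over the interval and
`⟨f_i, f_j⟩ / (λ_i λ_j)` over the lattice, up to `1 - q`. Normalizing the second to `δ_ij` makes the
first `λ_i λ_j δ_ij`.

Self-adjointness makes different eigenspaces orthogonal. No `λ_i` vanishes: otherwise `U f_i`,
essentially a convergent power series in `q^(2n)`, would vanish at points accumulating at `0`, hence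
everywhere (`tsum_besselKernel_eq_zero`), and the isometry would give `f_i = 0`. -/

theorem qPoch_zero (z q : ℝ) : qPoch z q 0 = 1 := by simp [qPoch]

theorem qPoch_succ (z q : ℝ) (n : ℕ) : qPoch z q (n + 1) = qPoch z q n * (1 - z * q ^ n) := by
  simp [qPoch, prod_range_succ]

theorem qPoch_pos {z q : ℝ} (hq0 : 0 < q) (hq1 : q < 1) (hz : z < 1) (n : ℕ) :
    0 < qPoch z q n := by
  refine prod_pos fun i _ => ?_
  have h1 : q ^ i ≤ 1 := pow_le_one₀ hq0.le hq1.le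
  have h2 : 0 < q ^ i := pow_pos hq0 i
  rcases le_total z 0 with h | h <;> nlinarith

/-- Coefficients of the `q`-exponential series `∑ zᵏ / (q; q)_k = 1 / (z; q)_∞`. -/
def smallExpCoeff (q : ℝ) (n : ℕ) : ℝ := 1 / qPoch q q n

/-- Coefficients of the `q`-exponential series `(z; q)_∞ = ∑ (-1)ᵏ q^(k choose 2) zᵏ / (q; q)_k`. -/
def bigExpCoeff (q : ℝ) (n : ℕ) : ℝ := (-1) ^ n * q ^ n.choose 2 / qPoch q q n

section

variable {q : ℝ} (hq0 : 0 < q) (hq1 : q < 1)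

include hq0 hq1

theorem one_sub_pow_succ_pos (n : ℕ) : 0 < 1 - q ^ (n + 1) :=
  sub_pos.2 (pow_lt_one₀ hq0.le hq1 n.succ_ne_zero)

theorem smallExpCoeff_succ (n : ℕ) :
    smallExpCoeff q (n + 1) * (1 - q ^ (n + 1)) = smallExpCoeff q n := by
  have h := (qPoch_pos hq0 hq1 hq1 n).ne'
  have h' := (one_sub_pow_succ_pos hq0 hq1 n).ne'
  rw [smallExpCoeff, smallExpCoeff, qPoch_succ, ← pow_succ']
  field_simp

theorem bigExpCoeff_succ (n : ℕ) :
    bigExpCoeff q (n + 1) * (1 - q ^ (n + 1)) = -(q ^ n * bigExpCoeff q n) := by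
  have h := (qPoch_pos hq0 hq1 hq1 n).ne'
  have h' := (one_sub_pow_succ_pos hq0 hq1 n).ne'
  rw [bigExpCoeff, bigExpCoeff, qPoch_succ, ← pow_succ', Nat.choose_succ_succ' n 1,
    Nat.choose_one_right, pow_add]
  field_simp
  ring

theorem smallExpCoeff_pos (n : ℕ) : 0 < smallExpCoeff q n :=
  one_div_pos.2 (qPoch_pos hq0 hq1 hq1 n)

theorem bigExpCoeff_ne_zero (n : ℕ) : bigExpCoeff q n ≠ 0 := by
  have h := (qPoch_pos hq0 hq1 hq1 n).ne'
  simp [bigExpCoeff, h, hq0.ne']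

theorem tendsto_one_sub_pow_succ : Tendsto (fun n : ℕ => 1 - q ^ (n + 1)) atTop (𝓝 1) := by
  have := (tendsto_pow_atTop_nhds_zero_of_lt_one hq0.le hq1).comp (tendsto_add_atTop_nat 1)
  simpa using this.const_sub 1

theorem summable_smallExpCoeff {r : ℝ} (hr0 : 0 < r) (hr1 : r < 1) :
    Summable fun n : ℕ => r ^ n * smallExpCoeff q n := by
  refine summable_of_ratio_test_tendsto_lt_one hr1
    (.of_forall fun n => (mul_pos (pow_pos hr0 n) (smallExpCoeff_pos hq0 hq1 n)).ne') ?_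
  have h := (tendsto_one_sub_pow_succ hq0 hq1).inv₀ one_ne_zero |>.const_mul r
  rw [inv_one, mul_one] at h
  refine h.congr fun n => ?_
  have h1 := smallExpCoeff_pos hq0 hq1 n
  have h2 := smallExpCoeff_pos hq0 hq1 (n + 1)
  have h3 := one_sub_pow_succ_pos hq0 hq1 n
  rw [Real.norm_of_nonneg (by positivity), Real.norm_of_nonneg (by positivity),
    ← smallExpCoeff_succ hq0 hq1 n]
  field_simp
  ring

theorem summable_abs_bigExpCoeff (z : ℝ) :
    Summable fun n : ℕ => |bigExpCoeff q n * z ^ n| := by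
  rcases eq_or_ne z 0 with rfl | hz
  · exact summable_of_ne_finset_zero (s := {0}) fun n hn => by simp_all
  refine Summable.abs ?_
  refine summable_of_ratio_test_tendsto_lt_one (l := 0) zero_lt_one
    (.of_forall fun n => mul_ne_zero (bigExpCoeff_ne_zero hq0 hq1 n) (pow_ne_zero n hz)) ?_
  have h := ((tendsto_pow_atTop_nhds_zero_of_lt_one hq0.le hq1).mul
    ((tendsto_one_sub_pow_succ hq0 hq1).inv₀ one_ne_zero)).const_mul |z|
  rw [zero_mul, mul_zero] at h
  refine h.congr fun n => ?_
  have h1 := abs_pos.2 (bigExpCoeff_ne_zero hq0 hq1 n)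
  have h3 := one_sub_pow_succ_pos hq0 hq1 n
  have h4 := abs_pos.2 hz
  have h5 := congrArg abs (bigExpCoeff_succ hq0 hq1 n)
  rw [abs_neg, abs_mul, abs_mul, abs_of_pos h3, abs_of_pos (pow_pos hq0 n)] at h5
  simp only [Real.norm_eq_abs, abs_mul, abs_pow]
  rw [eq_div_iff (by positivity), pow_succ |z|, eq_div_of_mul_eq h3.ne' h5]
  ring

theorem summable_bigExpCoeff (z : ℝ) : Summable fun n : ℕ => bigExpCoeff q n * z ^ n :=
  (summable_abs_bigExpCoeff hq0 hq1 z).of_abs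

/-- The Cauchy product of the two `q`-exponential series is `1`. -/
theorem sum_antidiagonal_smallExpCoeff_bigExpCoeff (s : ℕ) :
    ∑ x ∈ antidiagonal s, smallExpCoeff q x.1 * bigExpCoeff q x.2 = if s = 0 then 1 else 0 := by
  let e : PowerSeries ℝ := .mk (smallExpCoeff q)
  let E : PowerSeries ℝ := .mk (bigExpCoeff q)
  -- The functional equations `e(qX) = (1 - X) e(X)` and `E(X) = (1 - X) E(qX)` make `e E` invariant
  -- under `X ↦ qX`. As `q^s ≠ 1` for `s > 0`, the product is constant.
  have he : PowerSeries.rescale q e = (1 - PowerSeries.X) * e := by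
    ext n
    rcases n with _ | n
    · simp [e, PowerSeries.coeff_rescale, sub_mul]
    · have := smallExpCoeff_succ hq0 hq1 n
      simp only [e, PowerSeries.coeff_rescale, sub_mul, PowerSeries.coeff_mk, one_mul, map_sub,
        PowerSeries.coeff_succ_X_mul]
      linarith
  have hE : E = (1 - PowerSeries.X) * PowerSeries.rescale q E := by
    ext n
    rcases n with _ | n
    · rw [PowerSeries.coeff_zero_eq_constantCoeff, map_mul,
        ← PowerSeries.coeff_zero_eq_constantCoeff, PowerSeries.coeff_rescale]
      simp
    · have := bigExpCoeff_succ hq0 hq1 n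
      simp only [E, PowerSeries.coeff_rescale, sub_mul, PowerSeries.coeff_mk, one_mul, map_sub,
        PowerSeries.coeff_succ_X_mul]
      linarith
  have hmul : PowerSeries.rescale q (e * E) = e * E := by
    conv_rhs => rw [hE]
    rw [map_mul, he]
    ring
  have hc := congrArg (PowerSeries.coeff s) hmul
  rw [PowerSeries.coeff_rescale, PowerSeries.coeff_mul] at hc
  simp only [e, E, PowerSeries.coeff_mk] at hc
  rcases s with _ | s
  · simp [smallExpCoeff, bigExpCoeff, qPoch_zero]
  · have h3 := one_sub_pow_succ_pos hq0 hq1 s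
    rw [if_neg s.succ_ne_zero]
    refine (mul_eq_zero.1 (?_ : (1 - q ^ (s + 1)) * _ = 0)).resolve_left h3.ne'
    linarith

theorem summable_norm_neg_mul_pow (z : ℝ) : Summable fun i : ℕ => ‖-(z * q ^ i)‖ := by
  simpa [abs_mul] using (summable_geometric_of_lt_one (abs_nonneg q)
    (by rwa [abs_of_pos hq0])).mul_left |z|

theorem tendsto_qPoch (z : ℝ) : Tendsto (qPoch z q) atTop (𝓝 (qPochInf z q)) := by
  have := (multipliable_one_add_of_summable (summable_norm_neg_mul_pow hq0 hq1 z)).hasProd.tendsto_prod_nat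
  simp only [← sub_eq_add_neg] at this
  exact this

/-- Iterates the functional equation `E(z) = (1 - z) E(zq)`. Letting `n → ∞` yields Euler's product.
-/
theorem tsum_bigExpCoeff_eq_qPoch_mul (z : ℝ) (n : ℕ) :
    ∑' k, bigExpCoeff q k * z ^ k = qPoch z q n * ∑' k, bigExpCoeff q k * (z * q ^ n) ^ k := by
  induction n with
  | zero => simp [qPoch_zero]
  | succ n ih =>
    rw [ih, qPoch_succ, mul_assoc]
    congr 1
    set y := z * q ^ n
    rw [pow_succ, ← mul_assoc, show z * q ^ n = y from rfl]
    have h1 := (summable_bigExpCoeff hq0 hq1 y).hasSum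
    have h2 := (summable_bigExpCoeff hq0 hq1 (y * q)).hasSum
    have h3 := (hasSum_nat_add_iff' 1).2 (h1.sub h2)
    have h4 := h2.mul_left (-y)
    have h5 : (fun k => -y * (bigExpCoeff q k * (y * q) ^ k)) = fun k =>
        bigExpCoeff q (k + 1) * y ^ (k + 1) - bigExpCoeff q (k + 1) * (y * q) ^ (k + 1) := by
      funext k
      have := bigExpCoeff_succ hq0 hq1 k
      linear_combination (-y ^ (k + 1)) * this
    rw [h5] at h4
    have h6 := h3.unique h4
    simp only [range_one, sum_singleton, pow_zero, sub_self, sub_zero] at h6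
    linear_combination h6

/-- Euler's expansion of `(z; q)_∞`. -/
theorem hasSum_bigExpCoeff (z : ℝ) :
    HasSum (fun k => bigExpCoeff q k * z ^ k) (qPochInf z q) := by
  have hs := summable_bigExpCoeff hq0 hq1 z
  convert hs.hasSum
  refine tendsto_nhds_unique (f := fun n => qPoch z q n * ∑' k, bigExpCoeff q k * (z * q ^ n) ^ k)
    (l := atTop) ?_ ?_
  · have h : Tendsto (fun n : ℕ => ∑' k, bigExpCoeff q k * (z * q ^ n) ^ k) atTop
        (𝓝 (∑' k, bigExpCoeff q k * 0 ^ k)) := by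
      refine tendsto_tsum_of_dominated_convergence (summable_abs_bigExpCoeff hq0 hq1 z)
        (fun k => ?_) (.of_forall fun n k => ?_)
      · have := (tendsto_pow_atTop_nhds_zero_of_lt_one hq0.le hq1).const_mul z
        rw [mul_zero] at this
        exact (this.pow k).const_mul _
      · rw [Real.norm_eq_abs, abs_mul, abs_mul, mul_pow, abs_mul]
        gcongr
        rw [← pow_mul, abs_of_pos (pow_pos hq0 _)]
        exact mul_le_of_le_one_right (abs_nonneg _) (pow_le_one₀ hq0.le hq1.le)
    have h0 : ∑' k, bigExpCoeff q k * 0 ^ k = 1 := by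
      rw [tsum_eq_single 0 fun k hk => by simp [hk]]
      simp [bigExpCoeff, qPoch_zero]
    rw [h0] at h
    simpa using (tendsto_qPoch hq0 hq1 z).mul h
  · simp_rw [← tsum_bigExpCoeff_eq_qPoch_mul hq0 hq1 z]
    exact tendsto_const_nhds

theorem qPoch_mul_qPochInf (z : ℝ) (n : ℕ) :
    qPoch z q n * qPochInf (z * q ^ n) q = qPochInf z q := by
  rw [← (hasSum_bigExpCoeff hq0 hq1 _).tsum_eq, ← (hasSum_bigExpCoeff hq0 hq1 z).tsum_eq]
  exact (tsum_bigExpCoeff_eq_qPoch_mul hq0 hq1 z n).symm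

theorem qPochInf_pos {z : ℝ} (hz0 : 0 < z) (hz1 : z < 1) : 0 < qPochInf z q := by
  have := tprod_one_add_ne_zero_of_summable (f := fun i : ℕ => -(z * q ^ i)) (fun i => ?_)
    (summable_norm_neg_mul_pow hq0 hq1 z)
  · simp only [← sub_eq_add_neg] at this
    exact lt_of_le_of_ne (ge_of_tendsto' (tendsto_qPoch hq0 hq1 z)
      fun n => (qPoch_pos hq0 hq1 hz1 n).le) (Ne.symm this)
  · rw [← sub_eq_add_neg]
    have h1 : q ^ i ≤ 1 := pow_le_one₀ hq0.le hq1.le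
    have h2 : 0 < q ^ i := pow_pos hq0 i
    nlinarith

theorem qPochInf_le_qPoch {z : ℝ} (hz0 : 0 < z) (hz1 : z < 1) (n : ℕ) :
    qPochInf z q ≤ qPoch z q n := by
  refine Antitone.le_of_tendsto (antitone_nat_of_succ_le fun n => ?_) (tendsto_qPoch hq0 hq1 z) n
  rw [qPoch_succ]
  exact mul_le_of_le_one_right (qPoch_pos hq0 hq1 hz1 n).le
    (sub_le_self _ (mul_pos hz0 (pow_pos hq0 n)).le)

end

/-! ### Unimodular convolution kernels on `ℤ` -/

/-- Extension of a function on `ℕ` to `ℤ` by zero. -/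
def zeroExt (f : ℕ → ℝ) (n : ℤ) : ℝ := if 0 ≤ n then f n.toNat else 0

theorem zeroExt_natCast (f : ℕ → ℝ) (n : ℕ) : zeroExt f n = f n := by simp [zeroExt]

theorem zeroExt_of_neg (f : ℕ → ℝ) {n : ℤ} (hn : n < 0) : zeroExt f n = 0 := by
  simp [zeroExt, hn]

theorem support_subset_range_natCast {g : ℤ → ℝ} (hg : ∀ n < 0, g n = 0) :
    Function.support g ⊆ Set.range ((↑) : ℕ → ℤ) := fun n hn => by
  have : 0 ≤ n := not_lt.1 fun h => hn (hg n h)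
  exact ⟨n.toNat, Int.toNat_of_nonneg this⟩

theorem tsum_int_of_neg_eq_zero {g : ℤ → ℝ} (hg : ∀ n < 0, g n = 0) :
    ∑' n, g n = ∑' n : ℕ, g n :=
  (Nat.cast_injective.tsum_eq (support_subset_range_natCast hg)).symm

theorem summable_int_of_neg_eq_zero {g : ℤ → ℝ} (hg : ∀ n < 0, g n = 0) :
    Summable g ↔ Summable fun n : ℕ => g n :=
  (Nat.cast_injective.summable_iff fun _ hn => Function.notMem_support.1 fun h =>
    hn (support_subset_range_natCast hg h)).symm

theorem summable_zeroExt {f : ℕ → ℝ} (hf : Summable f) : Summable (zeroExt f) := by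
  rw [summable_int_of_neg_eq_zero fun n hn => zeroExt_of_neg f hn]
  simpa only [zeroExt_natCast] using hf

/-- The correlation of `b` with `a`. -/
def correlation (a b : ℤ → ℝ) (n : ℤ) : ℝ := ∑' k, a (n + k) * b k

theorem summable_add_mul {a b : ℤ → ℝ} (ha : Summable a) (hb : Summable b) :
    Summable fun x : ℤ × ℤ => a (x.1 + x.2) * b x.2 := by
  have h : Summable fun x : ℤ × ℤ => a x.1 * b x.2 :=
    summable_mul_of_summable_norm ha.norm hb.norm
  let e : ℤ × ℤ ≃ ℤ × ℤ :=
    { toFun := fun x => (x.1 + x.2, x.2)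
      invFun := fun x => (x.1 - x.2, x.2)
      left_inv := fun x => by simp
      right_inv := fun x => by simp }
  exact (e.summable_iff (f := fun x : ℤ × ℤ => a x.1 * b x.2)).2 h

theorem summable_correlation {a b : ℤ → ℝ} (ha : Summable a) (hb : Summable b) :
    Summable (correlation a b) :=
  (summable_add_mul ha hb).prod

theorem exists_abs_le_of_summable {a : ℤ → ℝ} (ha : Summable a) : ∃ C, ∀ n, |a n| ≤ C :=
  ⟨∑' n, |a n|, fun n => ha.abs.le_tsum n fun _ _ => abs_nonneg _⟩

/-- If `b` is the convolution inverse of `a`, the correlation of `b` with `a` is orthonormal to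
its translates. -/
theorem tsum_correlation_mul_correlation {a b : ℤ → ℝ} (ha : Summable a) (hb : Summable b)
    (hab : ∀ s, ∑' l, a (s - l) * b l = if s = 0 then 1 else 0) (d : ℤ) :
    ∑' n, correlation a b n * correlation a b (n + d) = if d = 0 then 1 else 0 := by
  obtain ⟨C, hC⟩ := exists_abs_le_of_summable ha
  have hsec : ∀ c, Summable fun k => a (c + k) * b k := fun c =>
    (summable_add_mul ha hb).prod_factor c
  have hsec' : ∀ c, Summable fun k => a (c - k) * b k := fun c =>
    .of_norm_bounded (hb.abs.mul_left C) fun k => by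
      rw [Real.norm_eq_abs, abs_mul]
      gcongr
      exact hC _
  -- the triple sum, in the coordinates of the left-hand side
  let F : ℤ × ℤ × ℤ → ℝ := fun x =>
    (a (x.1 + x.2.1) * b x.2.1) * (a (x.1 + d + x.2.2) * b x.2.2)
  have hF : Summable F := by
    have h1 : Summable fun x : (ℤ × ℤ) × ℤ =>
        (|a (x.1.1 + x.1.2) * b x.1.2|) * (C * |b x.2|) :=
      Summable.mul_of_nonneg (summable_add_mul ha hb).abs (hb.abs.mul_left C)
        (fun _ => abs_nonneg _) fun k => mul_nonneg ((abs_nonneg _).trans (hC 0)) (abs_nonneg _)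
    refine Summable.of_norm_bounded ((Equiv.prodAssoc ℤ ℤ ℤ).symm.summable_iff.2 h1) fun x => ?_
    simp only [F, Function.comp, Equiv.prodAssoc_symm_apply, Real.norm_eq_abs]
    rw [abs_mul, abs_mul (a (x.1 + d + x.2.2))]
    gcongr
    exact hC _
  -- With `s = n + k + l`, the factor `a (n + k)` becomes `a (s - l)` and `a (n + d + l)` becomes `a
  -- (s + d - k)`. The two factors exchange their `b`-partners, and two convolutions appear.
  let e : ℤ × ℤ × ℤ ≃ ℤ × ℤ × ℤ :=
    { toFun := fun x => (x.1 - x.2.1 - x.2.2, x.2.2, x.2.1)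
      invFun := fun x => (x.1 + x.2.1 + x.2.2, x.2.2, x.2.1)
      left_inv := fun x => by ext <;> simp
      right_inv := fun x => by ext <;> simp }
  have hleft : ∑' x, F x = ∑' n, correlation a b n * correlation a b (n + d) := by
    rw [hF.tsum_prod]
    refine tsum_congr fun n => ?_
    rw [correlation, correlation]
    exact ((hsec n).tsum_mul_tsum (hsec (n + d)) (hF.prod_factor n)).symm
  have hFe : Summable (F ∘ e) := e.summable_iff.2 hF
  have hright : ∑' x, F (e x) = ∑' s, (∑' l, a (s - l) * b l) * ∑' k, a (s + d - k) * b k := by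
    refine (Summable.tsum_prod hFe).trans (tsum_congr fun s => ?_)
    have hs := hFe.prod_factor s
    have hFs : ∀ x : ℤ × ℤ, (F ∘ e) (s, x) =
        (a (s - x.1) * b x.1) * (a (s + d - x.2) * b x.2) := fun x => by
      simp only [F, e, Function.comp, Equiv.coe_fn_mk]
      rw [show s - x.1 - x.2 + x.2 = s - x.1 by ring,
        show s - x.1 - x.2 + d + x.1 = s + d - x.2 by ring]
      ring
    simp only [hFs] at hs
    rw [(hsec' s).tsum_mul_tsum (hsec' (s + d)) hs]
    exact tsum_congr hFs
  rw [← hleft, ← e.tsum_eq, hright]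
  simp only [hab]
  rw [tsum_eq_single 0 fun s hs => by simp [hs]]
  simp

/-- Real square-summable sequences on `ℤ`. -/
abbrev SqSummable : Type := lp (fun _ : ℤ => ℝ) 2

theorem hasSum_inner_sqSummable (f g : SqSummable) :
    HasSum (fun n => f n * g n) (inner ℝ f g) := by
  have h : ∀ x y : ℝ, x * y = inner ℝ x y := fun x y => by simp [mul_comm]
  have h' : (fun n => f n * g n) = fun n => inner ℝ (f n) (g n) := funext fun n => h _ _
  rw [h']
  exact lp.hasSum_inner f g

theorem inner_single_one_sqSummable (n : ℤ) (f : SqSummable) :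
    inner ℝ (lp.single 2 n (1 : ℝ) : SqSummable) f = f n :=
  (lp.inner_single_left (𝕜 := ℝ) (G := fun _ : ℤ => ℝ) n 1 f).trans (by simp)

theorem hasSum_mul_inner {E : Type*} [NormedAddCommGroup E] [InnerProductSpace ℝ E] {ι : Type*}
    {c : ι → ℝ} {K : ι → E} {w : E} (h : HasSum (fun m => c m • K m) w) (x : E) :
    HasSum (fun m => c m * inner ℝ x (K m)) (inner ℝ x w) := by
  simpa only [innerSL_apply_apply, inner_smul_right] using (innerSL ℝ x).hasSum h

/-- A Hankel kernel with orthonormal rows is a self-adjoint isometry of `ℓ²(ℤ)`. -/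
theorem exists_hankel_isometry {k : ℤ → ℝ} (hk : Summable k)
    (horth : ∀ d, ∑' n, k n * k (n + d) = if d = 0 then 1 else 0) :
    ∃ U : SqSummable → SqSummable, (∀ f n, HasSum (fun m => k (n + m) * f m) (U f n)) ∧
      (∀ f g, inner ℝ (U f) (U g) = inner ℝ f g) ∧
      ∀ f g, inner ℝ (U f) g = inner ℝ f (U g) := by
  have hk1 : ∀ m, Summable fun n => k (m + n) := fun m =>
    (Equiv.addLeft m).summable_iff.2 hk
  have hmem : ∀ m : ℤ, Memℓp (fun n => k (m + n)) 2 := fun m =>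
    Memℓp.of_exponent_ge (memℓp_gen (p := 1) (by simpa using (hk1 m).abs)) one_le_two
  let K : ℤ → SqSummable := fun m => ⟨fun n => k (m + n), hmem m⟩
  have hKapp : ∀ m n, K m n = k (m + n) := fun _ _ => rfl
  have hkk : ∀ m n, ∑' i, k (m + i) * k (n + i) = if m = n then 1 else 0 := fun m n => by
    rw [← (Equiv.addLeft (-m)).tsum_eq]
    have := horth (n - m)
    simp only [sub_eq_zero, eq_comm (a := n)] at this
    rw [← this]
    refine tsum_congr fun i => ?_
    rw [Equiv.coe_addLeft, show m + (-m + i) = i by ring, show n + (-m + i) = i + (n - m) by ring]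
  have hKK : ∀ m n, inner ℝ (K m) (K n) = if m = n then 1 else 0 := fun m n =>
    (hasSum_inner_sqSummable _ _).tsum_eq.symm.trans (hkk m n)
  have hon : Orthonormal ℝ K := orthonormal_iff_ite.2 hKK
  -- Since `k (n + m)` is symmetric, the rows are also the columns. Expanding in them with
  -- coefficients `k (n + m)` recovers the unit vectors, so the family is complete.
  have hspan : (Submodule.span ℝ (Set.range K))ᗮ = ⊥ := by
    refine (Submodule.eq_bot_iff _).2 fun f hf => ?_
    have hf' : ∀ m, inner ℝ f (K m) = 0 := fun m =>
      (real_inner_comm _ _).trans (hf _ (Submodule.subset_span ⟨m, rfl⟩))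
    ext n
    -- `∑ₘ k (n + m) K m` is the `n`-th unit vector
    have hsum : Summable fun m => k (n + m) • K m :=
      .of_norm_bounded (hk1 n).norm fun m => by rw [norm_smul, hon.1 m, mul_one]
    have hw : ∑' m, k (n + m) • K m = lp.single 2 n (1 : ℝ) := by
      ext l
      have h := hasSum_mul_inner hsum.hasSum (lp.single 2 l (1 : ℝ))
      simp only [inner_single_one_sqSummable, hKapp] at h
      rw [← h.tsum_eq]
      have h2 := hkk n l
      simp only [add_comm l] at h2
      refine h2.trans ?_
      simp [lp.single_apply, Pi.single_apply, eq_comm]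
    have := hasSum_mul_inner hsum.hasSum f
    rw [hw, real_inner_comm, inner_single_one_sqSummable] at this
    simp only [hf', mul_zero] at this
    exact this.unique hasSum_zero
  let B : HilbertBasis ℤ ℝ SqSummable := HilbertBasis.mkOfOrthogonalEqBot hon hspan
  have hB : ∀ m, B m = K m := fun m => by
    rw [HilbertBasis.coe_mkOfOrthogonalEqBot]
  have hU : ∀ f n, B.repr f n = inner ℝ (K n) f := fun f n => by
    rw [B.repr_apply_apply, hB]
  -- Symmetry of the kernel makes the isometry an involution, and an isometric involution is
  -- self-adjoint.
  have hUs : ∀ f, B.repr.symm f = B.repr f := fun f => by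
    ext n
    rw [← inner_single_one_sqSummable, ← B.repr.inner_map_map, LinearIsometryEquiv.apply_symm_apply, hU]
    congr 1
    ext m
    rw [hU, real_inner_comm, inner_single_one_sqSummable, hKapp, hKapp, add_comm]
  refine ⟨B.repr, fun f n => ?_, B.repr.inner_map_map, fun f g => ?_⟩
  · rw [hU]
    exact hasSum_inner_sqSummable _ _
  · rw [← hUs f, ← B.repr.inner_map_map, LinearIsometryEquiv.apply_symm_apply]

/-! ### The `q`-Bessel kernel -/

/-- Coefficients of the normalized Hahn-Exton `q`-Bessel function as a power series in `z²`, with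
base `p` and `w = p ^ (v + 1)`. -/
def besselCoeff (p w : ℝ) (n : ℕ) : ℝ :=
  (-1) ^ n * (p ^ (n * (n + 1) / 2) / (qPoch p p n * qPoch w p n))

/-- The Hankel kernel `r ^ n * ∑ k, (-1)ᵏ p^(k choose 2) r ^ (2 k) / ((p; p)_k (p; p)_(n + k))`. -/
def besselKernel (p r : ℝ) : ℤ → ℝ :=
  correlation (zeroExt fun n => r ^ n * smallExpCoeff p n)
    (zeroExt fun n => bigExpCoeff p n * r ^ n)

theorem besselCoeff_eq (p w : ℝ) (n : ℕ) :
    besselCoeff p w n = bigExpCoeff p n * p ^ n / qPoch w p n := by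
  have h : n * (n + 1) / 2 = n.choose 2 + n := by
    have := Nat.choose_two_right (n + 1)
    rw [Nat.choose_succ_succ' n 1, Nat.choose_one_right, Nat.add_sub_cancel] at this
    rw [mul_comm, ← this, add_comm]
  rw [besselCoeff, bigExpCoeff, h, pow_add]
  ring

section

variable {p : ℝ} (hp0 : 0 < p) (hp1 : p < 1)

include hp0 hp1

theorem summable_abs_besselCoeff {w : ℝ} (hw0 : 0 < w) (hw1 : w < 1) (z : ℝ) :
    Summable fun n => |besselCoeff p w n * z ^ n| := by
  have hL := qPochInf_pos hp0 hp1 hw0 hw1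
  refine .of_nonneg_of_le (fun _ => abs_nonneg _) (fun n => ?_)
    ((summable_abs_bigExpCoeff hp0 hp1 (p * z)).mul_right (qPochInf w p)⁻¹)
  rw [besselCoeff_eq, mul_pow, div_mul_eq_mul_div, abs_div, ← mul_assoc, ← div_eq_mul_inv,
    abs_of_pos (qPoch_pos hp0 hp1 hw1 n)]
  gcongr
  exact qPochInf_le_qPoch hp0 hp1 hw0 hw1 n

/-- For `m < 0` the product contains the factor `1 - p^0 = 0`, which is why extension by zero is the
right convention for `1 / (p; p)_m`. -/
theorem qPochInf_zpow (m : ℤ) :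
    qPochInf (p ^ (m + 1)) p = qPochInf p p * zeroExt (smallExpCoeff p) m := by
  rcases lt_or_ge m 0 with hm | hm
  · obtain ⟨i, rfl⟩ : ∃ i : ℕ, m = -(i + 1 : ℤ) := ⟨(-m - 1).toNat, by omega⟩
    rw [zeroExt_of_neg _ hm, mul_zero, ← qPoch_mul_qPochInf hp0 hp1 _ (i + 1), qPoch_succ,
      ← zpow_natCast p i, ← zpow_add₀ hp0.ne']
    simp
  · obtain ⟨i, rfl⟩ := Int.eq_ofNat_of_zero_le hm
    have := (qPoch_pos hp0 hp1 hp1 i).ne'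
    rw [zeroExt_natCast, ← qPoch_mul_qPochInf hp0 hp1 p i, smallExpCoeff, zpow_add₀ hp0.ne',
      zpow_natCast, zpow_one, mul_comm p]
    field_simp

/-- The expansion of the `q`-Bessel function at lattice points that interchanges the roles of the
argument and of the parameter. -/
theorem qPochInf_div_mul_tsum_besselCoeff {w : ℝ} (hw1 : w < 1) (n : ℤ) :
    qPochInf w p / qPochInf p p * ∑' j, besselCoeff p w j * (p ^ n) ^ j =
      ∑' k : ℕ, bigExpCoeff p k * w ^ k * zeroExt (smallExpCoeff p) (n + k) := by
  have hP := (qPochInf_pos hp0 hp1 hp0 hp1).ne'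
  -- Euler's expansion of `(w p^j; p)_∞ = (w; p)_∞ / (w; p)_j` makes the left side a double series.
  -- Summing over `j` first gives `(p^(n+k+1); p)_∞` by Euler again.
  let F : ℕ × ℕ → ℝ := fun x =>
    (bigExpCoeff p x.1 * (p ^ (n + 1)) ^ x.1) * (bigExpCoeff p x.2 * (w * p ^ x.1) ^ x.2)
  have hF : Summable F := by
    refine .of_norm_bounded ((summable_abs_bigExpCoeff hp0 hp1 (p ^ (n + 1))).mul_of_nonneg
      (summable_abs_bigExpCoeff hp0 hp1 w) (fun _ => abs_nonneg _) fun _ => abs_nonneg _)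
      fun x => ?_
    rw [Real.norm_eq_abs, abs_mul, mul_pow w, ← mul_assoc (bigExpCoeff p x.2), abs_mul (_ * _)]
    gcongr
    rw [← pow_mul, abs_of_pos (pow_pos hp0 _)]
    exact mul_le_of_le_one_right (abs_nonneg _) (pow_le_one₀ hp0.le hp1.le)
  have h1 : ∀ j, ∑' k, F (j, k) = qPochInf w p * (besselCoeff p w j * (p ^ n) ^ j) := fun j => by
    have h := (qPoch_pos hp0 hp1 hw1 j).ne'
    simp only [F]
    rw [tsum_mul_left, (hasSum_bigExpCoeff hp0 hp1 _).tsum_eq, besselCoeff_eq,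
      ← qPoch_mul_qPochInf hp0 hp1 w j, zpow_add₀ hp0.ne', mul_pow, zpow_one]
    field_simp
  have h2 : ∀ k, ∑' j, F (j, k) =
      qPochInf p p * (bigExpCoeff p k * w ^ k * zeroExt (smallExpCoeff p) (n + k)) := fun k => by
    have : ∀ j, F (j, k) =
        (bigExpCoeff p k * w ^ k) * (bigExpCoeff p j * (p ^ (n + k + 1)) ^ j) := fun j => by
      simp only [F]
      rw [show n + k + 1 = (n + 1) + k by ring, zpow_add₀ hp0.ne' (n + 1), mul_pow, mul_pow,
        zpow_natCast, ← pow_mul, ← pow_mul, mul_comm j k]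
      ring
    simp only [this]
    rw [tsum_mul_left, (hasSum_bigExpCoeff hp0 hp1 _).tsum_eq, qPochInf_zpow hp0 hp1]
    ring
  have h3 := hF.tsum_comm' (fun j => hF.prod_factor j)
    (fun k => ((Equiv.prodComm ℕ ℕ).summable_iff.2 hF).prod_factor k)
  simp only [h1, h2, tsum_mul_left] at h3
  rw [div_mul_eq_mul_div, ← h3]
  field_simp

/-- The choice `w = r²` splits the weight symmetrically: `r^n w^k = r^(n+k) r^k`, one factor for
each `q`-exponential series. -/
theorem besselKernel_eq {r : ℝ} (hr0 : 0 < r) (hr1 : r < 1) (n : ℤ) :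
    besselKernel p r n = r ^ n * (qPochInf (r ^ 2) p / qPochInf p p *
      ∑' j, besselCoeff p (r ^ 2) j * (p ^ n) ^ j) := by
  rw [qPochInf_div_mul_tsum_besselCoeff hp0 hp1 (pow_lt_one₀ hr0.le hr1 two_ne_zero),
    besselKernel, correlation, tsum_int_of_neg_eq_zero fun k hk => by
      rw [zeroExt_of_neg _ hk, mul_zero], ← tsum_mul_left]
  refine tsum_congr fun k => ?_
  rw [zeroExt_natCast]
  rcases lt_or_ge (n + k) 0 with h | h
  · rw [zeroExt_of_neg _ h, zeroExt_of_neg _ h]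
    ring
  · obtain ⟨i, hi⟩ := Int.eq_ofNat_of_zero_le h
    have hn : n = i - k := by omega
    rw [hi, zeroExt_natCast, zeroExt_natCast, hn, zpow_sub₀ hr0.ne', zpow_natCast, zpow_natCast,
      ← pow_mul, mul_comm 2, pow_mul]
    field_simp

theorem summable_besselKernel {r : ℝ} (hr0 : 0 < r) (hr1 : r < 1) :
    Summable (besselKernel p r) :=
  summable_correlation (summable_zeroExt (summable_smallExpCoeff hp0 hp1 hr0 hr1))
    (summable_zeroExt (summable_bigExpCoeff hp0 hp1 r))

theorem tsum_besselKernel_mul_besselKernel {r : ℝ} (hr0 : 0 < r) (hr1 : r < 1) (d : ℤ) :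
    ∑' n, besselKernel p r n * besselKernel p r (n + d) = if d = 0 then 1 else 0 := by
  refine tsum_correlation_mul_correlation
    (summable_zeroExt (summable_smallExpCoeff hp0 hp1 hr0 hr1))
    (summable_zeroExt (summable_bigExpCoeff hp0 hp1 r)) (fun s => ?_) d
  rw [tsum_int_of_neg_eq_zero fun k hk => by rw [zeroExt_of_neg _ hk, mul_zero]]
  rcases lt_or_ge s 0 with h | h
  · rw [if_neg h.ne]
    refine (tsum_congr fun l => ?_).trans tsum_zero
    rw [zeroExt_of_neg _ (by omega), zero_mul]
  · obtain ⟨i, rfl⟩ := Int.eq_ofNat_of_zero_le h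
    have hs := sum_antidiagonal_smallExpCoeff_bigExpCoeff hp0 hp1 i
    rw [← Nat.sum_antidiagonal_swap, Nat.sum_antidiagonal_eq_sum_range_succ_mk] at hs
    rw [tsum_eq_sum (s := range (i + 1)) fun l hl => by
      rw [zeroExt_of_neg _ (by simp at hl; omega), zero_mul]]
    simp only [Nat.cast_eq_zero]
    -- The powers of `r` in the convolution combine to `r^i`, which is harmless because only `i = 0`
    -- survives.
    have : (if i = 0 then (1 : ℝ) else 0) = r ^ i * if i = 0 then 1 else 0 := by
      split_ifs with h0 <;> simp [h0]
    rw [this, ← hs, mul_sum]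
    refine sum_congr rfl fun l hl => ?_
    have hl' : l ≤ i := by simp at hl; omega
    rw [← Nat.cast_sub hl', zeroExt_natCast, zeroExt_natCast]
    simp only [Prod.swap]
    rw [← Nat.sub_add_cancel hl', pow_add, Nat.sub_add_cancel hl']
    ring

end

/-! ### Superpositions of dilates of an entire function -/

/-- An everywhere convergent power series that vanishes at all large powers of `p` is zero. -/
theorem coeff_eq_zero_of_tsum_pow_eq_zero {p : ℝ} (hp0 : 0 < p) (hp1 : p < 1) {c : ℕ → ℝ}
    (hc : Summable c) {n₀ : ℕ} (h : ∀ n ≥ n₀, ∑' j, c j * (p ^ n) ^ j = 0) (j : ℕ) : c j = 0 := by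
  induction j using Nat.strong_induction_on with
  | _ j ih =>
    have hcj : Summable fun i => c (i + j) := (summable_nat_add_iff j).2 hc
    -- Once the lower coefficients vanish, dividing the series by `(p^n)^j` and letting `n → ∞`
    -- isolates `c j`.
    have hlim : Tendsto (fun n : ℕ => ∑' i, c (i + j) * (p ^ n) ^ i) atTop
        (𝓝 (∑' i, c (i + j) * 0 ^ i)) := by
      refine tendsto_tsum_of_dominated_convergence hcj.abs (fun i => ?_)
        (.of_forall fun n i => ?_)
      · exact ((tendsto_pow_atTop_nhds_zero_of_lt_one hp0.le hp1).pow i).const_mul _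
      · rw [Real.norm_eq_abs, abs_mul, ← pow_mul, abs_of_pos (pow_pos hp0 _)]
        exact mul_le_of_le_one_right (abs_nonneg _) (pow_le_one₀ hp0.le hp1.le)
    rw [tsum_eq_single 0 fun i hi => by simp [hi]] at hlim
    simp only [zero_add, pow_zero, mul_one] at hlim
    refine tendsto_nhds_unique hlim (tendsto_const_nhds.congr' ?_)
    filter_upwards [eventually_ge_atTop n₀] with n hn
    have hs : Summable fun i => c i * (p ^ n) ^ i := .of_norm_bounded hc.abs fun i => by
      rw [Real.norm_eq_abs, abs_mul, ← pow_mul, abs_of_pos (pow_pos hp0 _)]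
      exact mul_le_of_le_one_right (abs_nonneg _) (pow_le_one₀ hp0.le hp1.le)
    have h0 := h n hn
    rw [← hs.sum_add_tsum_nat_add j, sum_eq_zero fun i hi => by
      rw [ih i (mem_range.1 hi), zero_mul], zero_add] at h0
    simp only [pow_add, ← mul_assoc] at h0
    rw [tsum_mul_right] at h0
    exact ((mul_eq_zero.1 h0).resolve_right (pow_pos (pow_pos hp0 n) j).ne').symm

/-- Interchanging the sums shows that the superposition is itself a power series in `z`, with
coefficients `φ j` times moments of `g`. The identity principle then applies. -/
theorem tsum_dilates_eq_zero {p : ℝ} (hp0 : 0 < p) (hp1 : p < 1) {φ g : ℕ → ℝ}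
    (hφ : ∀ z, Summable fun j => |φ j * z ^ j|) (hg : Summable g) {n₀ : ℕ}
    (h : ∀ n ≥ n₀, ∑' m, (∑' j, φ j * (p ^ n * p ^ m) ^ j) * g m = 0) (z : ℝ) :
    ∑' m, (∑' j, φ j * (z * p ^ m) ^ j) * g m = 0 := by
  let c : ℕ → ℝ := fun j => φ j * ∑' m, (p ^ m) ^ j * g m
  have key : ∀ z, Summable (fun j => c j * z ^ j) ∧
      ∑' m, (∑' j, φ j * (z * p ^ m) ^ j) * g m = ∑' j, c j * z ^ j := fun z => by
    let F : ℕ × ℕ → ℝ := fun x => φ x.1 * (z * p ^ x.2) ^ x.1 * g x.2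
    have hF : Summable F := by
      refine .of_norm_bounded ((hφ z).mul_of_nonneg hg.abs (fun _ => abs_nonneg _)
        fun _ => abs_nonneg _) fun x => ?_
      rw [Real.norm_eq_abs, abs_mul, mul_pow z, ← mul_assoc, abs_mul (_ * _)]
      gcongr
      rw [← pow_mul, abs_of_pos (pow_pos hp0 _)]
      exact mul_le_of_le_one_right (abs_nonneg _) (pow_le_one₀ hp0.le hp1.le)
    have h1 : ∀ j, ∑' m, F (j, m) = c j * z ^ j := fun j => by
      have : ∀ m, F (j, m) = φ j * z ^ j * ((p ^ m) ^ j * g m) := fun m => by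
        simp only [F, mul_pow]
        ring
      simp only [this, c, tsum_mul_left]
      ring
    have h2 : ∀ m, ∑' j, F (j, m) = (∑' j, φ j * (z * p ^ m) ^ j) * g m := fun m => by
      simp only [F]
      exact tsum_mul_right
    have h3 := hF.tsum_comm' (fun j => hF.prod_factor j)
      (fun k => ((Equiv.prodComm ℕ ℕ).summable_iff.2 hF).prod_factor k)
    simp only [h1, h2] at h3
    refine ⟨?_, h3⟩
    simpa only [h1] using hF.prod
  have hc : Summable c := by simpa using (key 1).1
  have hc0 := coeff_eq_zero_of_tsum_pow_eq_zero hp0 hp1 hc (n₀ := n₀) fun n hn => by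
    rw [← (key _).2, h n hn]
  rw [(key z).2]
  simp [hc0]

/-! ### Jackson integrals as sums over `ℤ` -/

/-- The sequence `n ↦ q ^ (n (v + 1)) f (q ^ n)`, which identifies the weighted `L²`-space on the
lattice with `ℓ²(ℤ)`. -/
def latticeSeq (q v : ℝ) (f : ℝ → ℝ) (n : ℤ) : ℝ := (q ^ (v + 1)) ^ n * f (q ^ n)

/-- `latticeSeq`, cut off to the lattice points of `[0, q ^ N]_q`. -/
def intervalSeq (q v : ℝ) (N : ℤ) (f : ℝ → ℝ) (n : ℤ) : ℝ :=
  if N ≤ n then latticeSeq q v f n else 0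

/-- The Jackson weight is a perfect square, so each factor of an inner product can carry half of it.
-/
theorem zpow_mul_rpow {q : ℝ} (hq0 : 0 < q) (v : ℝ) (n : ℤ) :
    q ^ n * (q ^ n) ^ (2 * v + 1) = (q ^ (v + 1)) ^ n * (q ^ (v + 1)) ^ n := by
  have hx : 0 < q ^ n := zpow_pos hq0 n
  have h1 : (q ^ (v + 1)) ^ n = (q ^ n) ^ (v + 1) := by
    rw [← Real.rpow_intCast, ← Real.rpow_intCast, ← Real.rpow_mul hq0.le, ← Real.rpow_mul hq0.le,
      mul_comm]
  rw [h1, ← Real.rpow_add hx]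
  nth_rewrite 1 [← Real.rpow_one (q ^ n)]
  rw [← Real.rpow_add hx]
  ring_nf

theorem hasSum_intervalSeq_iff {q : ℝ} (v : ℝ) (N : ℤ) (g : ℤ → ℝ) (u : ℝ → ℝ) (S : ℝ) :
    HasSum (fun n => g n * intervalSeq q v N u n) S ↔
      HasSum (fun n : ℕ => g (N + n) * latticeSeq q v u (N + n)) S := by
  have hN : ∀ n < 0, g (N + n) * intervalSeq q v N u (N + n) = 0 := fun n hn => by
    rw [intervalSeq, if_neg (by omega), mul_zero]
  rw [← (Equiv.addLeft N).hasSum_iff, ← Nat.cast_injective.hasSum_iff fun n hn => ?_]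
  · refine iff_of_eq (congrArg (HasSum · S) (funext fun n => ?_))
    simp [intervalSeq]
  · exact Function.notMem_support.1 fun h => hn (support_subset_range_natCast hN h)

theorem jacksonIntegrable_and_jackson_eq {q : ℝ} (hq0 : 0 < q) {v : ℝ} {N : ℤ} {f g : ℝ → ℝ}
    {S : ℝ} (h : HasSum (fun n => intervalSeq q v N f n * intervalSeq q v N g n) S) :
    JacksonIntegrable q (q ^ N) (fun x => f x * g x * x ^ (2 * v + 1)) ∧
      jackson q (q ^ N) (fun x => f x * g x * x ^ (2 * v + 1)) = (1 - q) * S := by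
  rw [hasSum_intervalSeq_iff] at h
  have hq := zpow_pos hq0 N
  have : (fun n : ℕ => q ^ n * (f (q ^ N * q ^ n) * g (q ^ N * q ^ n) *
      (q ^ N * q ^ n) ^ (2 * v + 1))) = fun n : ℕ => (q ^ N)⁻¹ *
        (intervalSeq q v N f (N + n) * latticeSeq q v g (N + n)) := by
    funext n
    have := zpow_mul_rpow hq0 v (N + n)
    rw [intervalSeq, if_pos (by omega), latticeSeq, latticeSeq, mul_mul_mul_comm, ← this,
      zpow_add₀ hq0.ne', zpow_natCast]
    field_simp
  have h' := h.mul_left (q ^ N)⁻¹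
  rw [← this] at h'
  refine ⟨h'.summable, ?_⟩
  rw [jackson, h'.tsum_eq]
  field_simp

theorem jacksonTopIntegrable_and_jacksonTop_eq {q : ℝ} (hq0 : 0 < q) {v : ℝ} {f g : ℝ → ℝ}
    {S : ℝ} (h : HasSum (fun n => latticeSeq q v f n * latticeSeq q v g n) S) :
    JacksonTopIntegrable q (fun x => f x * g x * x ^ (2 * v + 1)) ∧
      jacksonTop q (fun x => f x * g x * x ^ (2 * v + 1)) = (1 - q) * S := by
  have : (fun n => latticeSeq q v f n * latticeSeq q v g n) = fun n : ℤ => q ^ n *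
      (f (q ^ n) * g (q ^ n) * (q ^ n) ^ (2 * v + 1)) := by
    funext n
    rw [latticeSeq, latticeSeq, mul_mul_mul_comm, ← zpow_mul_rpow hq0 v n]
    ring
  rw [this] at h
  exact ⟨h.summable, by rw [jacksonTop, h.tsum_eq]⟩

theorem memℓp_intervalSeq {q : ℝ} (hq0 : 0 < q) {v : ℝ} {N : ℤ} {f : ℝ → ℝ}
    (h : MemL2 q v (q ^ N) f) : Memℓp (intervalSeq q v N f) 2 := by
  refine memℓp_gen (Summable.congr (f := fun n => intervalSeq q v N f n * intervalSeq q v N f n)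
    ?_ fun n => by simp [sq])
  have : (fun n : ℕ => intervalSeq q v N f (N + n) * latticeSeq q v f (N + n)) =
      fun n : ℕ => q ^ N * (q ^ n * (|f (q ^ N * q ^ n)| ^ 2 *
      (q ^ N * q ^ n) ^ (2 * v + 1))) := by
    funext n
    have := zpow_mul_rpow hq0 v (N + n)
    rw [intervalSeq, if_pos (by omega), latticeSeq, mul_mul_mul_comm, ← this,
      zpow_add₀ hq0.ne', zpow_natCast, sq_abs]
    ring
  have hs := (Summable.mul_left (q ^ N) h).hasSum
  rw [← this, ← hasSum_intervalSeq_iff] at hs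
  exact hs.summable

/-! ### The finite `q`-Bessel Fourier transform in `ℓ²(ℤ)` -/

section

variable {q v : ℝ} (hq0 : 0 < q) (hq1 : q < 1) (hv : -1 < v)

include hq0

theorem sq_rpow_add_one (v : ℝ) : (q ^ 2) ^ (v + 1) = (q ^ (v + 1)) ^ 2 := by
  rw [← Real.rpow_natCast, ← Real.rpow_natCast, ← Real.rpow_mul hq0.le, ← Real.rpow_mul hq0.le,
    mul_comm]

theorem hahnExton_lattice (v : ℝ) (n : ℤ) :
    hahnExton v (q ^ n) (q ^ 2) =
      ∑' j, besselCoeff (q ^ 2) ((q ^ (v + 1)) ^ 2) j * ((q ^ 2) ^ n) ^ j := by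
  rw [hahnExton, sq_rpow_add_one hq0]
  refine tsum_congr fun j => ?_
  rw [besselCoeff, pow_mul, ← zpow_natCast (q ^ n) 2, ← zpow_natCast q 2, ← zpow_mul, ← zpow_mul,
    mul_comm n]

include hq1

theorem one_sub_mul_cConst (v : ℝ) :
    (1 - q) * cConst q v =
      qPochInf ((q ^ (v + 1)) ^ 2) (q ^ 2) / qPochInf (q ^ 2) (q ^ 2) := by
  have h : q ^ (2 * v + 2) = (q ^ (v + 1)) ^ 2 := by
    rw [← Real.rpow_natCast, ← Real.rpow_mul hq0.le]
    congr 1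
    push_cast
    ring
  have : (1 - q) ≠ 0 := (sub_pos.2 hq1).ne'
  rw [cConst, h]
  field_simp

include hv

theorem rpow_add_one_lt_one : q ^ (v + 1) < 1 := Real.rpow_lt_one hq0.le hq1 (by linarith)

/-- In `r^(m+n) = r^m r^n` with `r = q^(v+1)`, the factor `r^m` normalizes the output, while `r^n`
and the factor in `intervalSeq` together make up the Jackson weight. -/
theorem latticeSeq_finiteTransform (N : ℤ) (u : ℝ → ℝ) {m : ℤ} {S : ℝ}
    (h : HasSum (fun n => besselKernel (q ^ 2) (q ^ (v + 1)) (m + n) * intervalSeq q v N u n) S) :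
    latticeSeq q v (finiteTransform q v (q ^ N) u) m = S := by
  have hr0 : 0 < q ^ (v + 1) := Real.rpow_pos_of_pos hq0 _
  have hr1 := rpow_add_one_lt_one hq0 hq1 hv
  rw [hasSum_intervalSeq_iff] at h
  rw [← h.tsum_eq, latticeSeq, finiteTransform, jackson, ← tsum_mul_left, ← tsum_mul_left,
    ← tsum_mul_left]
  refine tsum_congr fun n => ?_
  have h1 := zpow_mul_rpow hq0 v (N + n)
  rw [besselKernel_eq (pow_pos hq0 2) (pow_lt_one₀ hq0.le hq1 two_ne_zero) hr0 hr1,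
    ← one_sub_mul_cConst hq0 hq1 v, ← hahnExton_lattice hq0, latticeSeq, zpow_add₀ hr0.ne' m,
    ← zpow_natCast q n, ← zpow_add₀ hq0.ne' N, ← zpow_add₀ hq0.ne' m]
  have h2 : q ^ N * q ^ (n : ℤ) = q ^ (N + n : ℤ) := (zpow_add₀ hq0.ne' _ _).symm
  linear_combination ((q ^ (v + 1)) ^ m * cConst q v * (1 - q) * u (q ^ (N + n : ℤ)) *
    hahnExton v (q ^ (m + (N + n) : ℤ)) (q ^ 2)) * (h1 + (q ^ (N + n : ℤ)) ^ (2 * v + 1) * h2)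

/-- A function on `[0, q ^ N]_q` whose finite `q`-Bessel Fourier transform vanishes on
`[0, q ^ N]_q` has a transform that vanishes on the whole lattice. -/
theorem tsum_besselKernel_eq_zero {N : ℤ} {u : ℝ → ℝ} {C : ℝ}
    (hC : ∀ n, |intervalSeq q v N u n| ≤ C)
    {S : ℤ → ℝ} (hS : ∀ m, HasSum (fun n => besselKernel (q ^ 2) (q ^ (v + 1)) (m + n) *
      intervalSeq q v N u n) (S m)) (h0 : ∀ m ≥ N, S m = 0) (m : ℤ) : S m = 0 := by
  have hr0 : 0 < q ^ (v + 1) := Real.rpow_pos_of_pos hq0 _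
  have hr1 := rpow_add_one_lt_one hq0 hq1 hv
  have hp0 := pow_pos hq0 2
  have hp1 := pow_lt_one₀ hq0.le hq1 two_ne_zero
  generalize hr : q ^ (v + 1) = r at *
  generalize hp : q ^ 2 = p at *
  have hA : qPochInf (r ^ 2) p / qPochInf p p ≠ 0 :=
    (div_pos (qPochInf_pos hp0 hp1 (pow_pos hr0 2) (pow_lt_one₀ hr0.le hr1 two_ne_zero))
      (qPochInf_pos hp0 hp1 hp0 hp1)).ne'
  let g : ℕ → ℝ := fun n => r ^ n * latticeSeq q v u (N + n)
  have hg : Summable g := by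
    refine .of_norm_bounded ((summable_geometric_of_lt_one hr0.le hr1).mul_right C) fun n => ?_
    have := hC (N + n)
    rw [intervalSeq, if_pos (by omega)] at this
    rw [Real.norm_eq_abs, abs_mul, abs_of_pos (pow_pos hr0 n)]
    gcongr
  have hSm : ∀ m, S m = r ^ (m + N) * (qPochInf (r ^ 2) p / qPochInf p p) *
      ∑' n, (∑' j, besselCoeff p (r ^ 2) j * (p ^ (m + N) * p ^ n) ^ j) * g n := fun m => by
    have h := hS m
    rw [hasSum_intervalSeq_iff] at h
    rw [← h.tsum_eq, ← tsum_mul_left]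
    refine tsum_congr fun n => ?_
    rw [besselKernel_eq hp0 hp1 hr0 hr1, ← add_assoc, zpow_add₀ hr0.ne' _ (n : ℤ),
      zpow_add₀ hp0.ne' _ (n : ℤ), zpow_natCast, zpow_natCast]
    ring
  -- The dilation point `p^n` corresponds to `m = n - N`, and `m ≥ N` means `n ≥ 2N`.
  rw [hSm, tsum_dilates_eq_zero hp0 hp1 (n₀ := (2 * N).toNat)
    (summable_abs_besselCoeff hp0 hp1 (pow_pos hr0 2) (pow_lt_one₀ hr0.le hr1 two_ne_zero)) hg
    fun n hn => ?_, mul_zero]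
  have h1 := hSm (n - N)
  rw [h0 _ (by omega), sub_add_cancel, zpow_natCast, zpow_natCast] at h1
  exact (mul_eq_zero.1 h1.symm).resolve_left (mul_ne_zero (pow_pos hr0 n).ne' hA)

end

/-! ### Eigenfunctions -/

theorem hasSum_mul_of_eq_const_mul {f g : SqSummable} {x y : ℤ → ℝ} {s t : ℝ}
    (hx : ∀ n, x n = s * f n) (hy : ∀ n, y n = t * g n) :
    HasSum (fun n => x n * y n) (s * t * inner ℝ f g) := by
  refine ((hasSum_inner_sqSummable f g).mul_left (s * t)).congr_fun fun n => ?_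
  rw [hx, hy, mul_mul_mul_comm]

/-- The transform of `ℓ²(ℤ)` with the `q`-Bessel kernel carries the truncation of `u i` to the
transform of `u i` on the lattice; the truncations are eigenvectors up to cut-off and are pairwise
orthogonal, and the eigenvalues do not vanish. -/
theorem IsEigenbasis.exists_sqSummable {q v : ℝ} (hq0 : 0 < q) (hq1 : q < 1) (hv : -1 < v) {N : ℤ}
    {u : ℕ → ℝ → ℝ} {lam : ℕ → ℝ} (hu : IsEigenbasis q v (q ^ N) u lam) :
    ∃ (f : ℕ → SqSummable) (U : SqSummable → SqSummable),
      (∀ g h, inner ℝ (U g) (U h) = inner ℝ g h) ∧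
      (∀ i n, f i n = intervalSeq q v N (u i) n) ∧
      (∀ i n, U (f i) n = latticeSeq q v (finiteTransform q v (q ^ N) (u i)) n) ∧
      (∀ i, ∀ n ≥ N, U (f i) n = lam i * f i n) ∧
      (∀ i, f i ≠ 0) ∧ (∀ i, lam i ≠ 0) ∧ ∀ i j, i ≠ j → inner ℝ (f i) (f j) = 0 := by
  have hr0 : 0 < q ^ (v + 1) := Real.rpow_pos_of_pos hq0 _
  have hr1 := rpow_add_one_lt_one hq0 hq1 hv
  have hp0 := pow_pos hq0 2
  have hp1 := pow_lt_one₀ hq0.le hq1 two_ne_zero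
  obtain ⟨U, hU, hiso, hself⟩ := exists_hankel_isometry (summable_besselKernel hp0 hp1 hr0 hr1)
    (tsum_besselKernel_mul_besselKernel hp0 hp1 hr0 hr1)
  let f : ℕ → SqSummable := fun i =>
    ⟨intervalSeq q v N (u i), memℓp_intervalSeq hq0 (hu.memL2 i)⟩
  have hf : ∀ i n, f i n = intervalSeq q v N (u i) n := fun _ _ => rfl
  have hUf : ∀ i n, U (f i) n = latticeSeq q v (finiteTransform q v (q ^ N) (u i)) n :=
    fun i n => (latticeSeq_finiteTransform hq0 hq1 hv N (u i) (hU (f i) n)).symm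
  have heig : ∀ i, ∀ n ≥ N, U (f i) n = lam i * f i n := fun i n hn => by
    have hmem : q ^ n ∈ interval q (q ^ N) :=
      ⟨(n - N).toNat, by
        rw [← zpow_natCast, ← zpow_add₀ hq0.ne', Int.toNat_of_nonneg (by omega)]; ring_nf⟩
    rw [hUf, hf, intervalSeq, if_pos hn, latticeSeq, latticeSeq, hu.eigen i _ hmem]
    ring
  have hf0 : ∀ i, f i ≠ 0 := fun i h => by
    obtain ⟨x, ⟨n, rfl⟩, hx⟩ := hu.ne_zero i
    have h1 : f i (N + n) = 0 := by rw [h]; rfl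
    rw [hf, intervalSeq, if_pos (by omega), latticeSeq, zpow_add₀ hq0.ne', zpow_natCast] at h1
    exact (mul_ne_zero (zpow_pos hr0 _).ne' hx) h1
  refine ⟨f, U, hiso, hf, hUf, heig, hf0, fun i hi => hf0 i ?_, fun i j hij => ?_⟩
  · have h0 : U (f i) = 0 := by
      ext m
      refine tsum_besselKernel_eq_zero hq0 hq1 hv (C := ‖f i‖)
        (fun n => lp.norm_apply_le_norm two_ne_zero (f i) n) (hU (f i)) (fun n hn => ?_) m
      rw [heig i n hn, hi, zero_mul]
    have := hiso (f i) (f i)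
    rw [h0, inner_zero_left] at this
    exact inner_self_eq_zero.1 this.symm
  · by_cases hl : lam i = lam j
    · have h1 := (jacksonIntegrable_and_jackson_eq hq0 (hasSum_inner_sqSummable (f i) (f j))).2
      rw [hu.orthogonal i j hij hl] at h1
      exact (mul_eq_zero.1 h1.symm).resolve_left (sub_pos.2 hq1).ne'
    -- The eigenvalue equation holds only for `n ≥ N`, but pairing with a cut-off sequence sees
    -- nothing else. The usual argument for a symmetric operator therefore applies.
    · have hcut : ∀ n, (n ≥ N ∨ ∀ i, f i n = 0) := fun n =>
        (le_or_gt N n).imp_right fun h i => by rw [hf, intervalSeq, if_neg (by omega)]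
      have h1 : HasSum (fun n => U (f i) n * f j n) (lam i * inner ℝ (f i) (f j)) := by
        refine ((hasSum_inner_sqSummable (f i) (f j)).mul_left (lam i)).congr_fun fun n => ?_
        rcases hcut n with h | h
        · rw [heig i n h, mul_assoc]
        · rw [h, mul_zero, mul_zero, mul_zero]
      have h2 : HasSum (fun n => f i n * U (f j) n) (lam j * inner ℝ (f i) (f j)) := by
        refine ((hasSum_inner_sqSummable (f i) (f j)).mul_left (lam j)).congr_fun fun n => ?_
        rcases hcut n with h | h
        · rw [heig j n h, mul_left_comm]
        · rw [h, zero_mul, zero_mul, mul_zero]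
      have h3 := h1.unique (hasSum_inner_sqSummable (U (f i)) (f j))
      rw [hself, ← h2.unique (hasSum_inner_sqSummable (f i) (U (f j)))] at h3
      have h4 : (lam i - lam j) * inner ℝ (f i) (f j) = 0 := by linear_combination h3
      exact (mul_eq_zero.1 h4).resolve_left (sub_ne_zero.2 hl)

end QProlate

end

/-! ### Normalization and the two orthogonality relations -/

theorem lemma2 (q v : ℝ) (hq0 : 0 < q) (hq1 : q < 1) (hv : -1 < v) (a : ℝ)
    (ha : a ∈ QProlate.lattice q) (u : ℕ → ℝ → ℝ) (lam : ℕ → ℝ)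
    (hu : QProlate.IsEigenbasis q v a u lam) (ψ : ℕ → ℝ → ℝ)
    (hψ : ∀ i, ψ i = QProlate.prolate q v a (lam i) (u i)) (i j : ℕ) :
    (QProlate.JacksonIntegrable q a (fun x => ψ i x * ψ j x * x ^ (2 * v + 1)) ∧
      QProlate.jackson q a (fun x => ψ i x * ψ j x * x ^ (2 * v + 1)) =
        lam i * lam j * (if i = j then 1 else 0)) ∧
    (QProlate.JacksonTopIntegrable q (fun x => ψ i x * ψ j x * x ^ (2 * v + 1)) ∧
      QProlate.jacksonTop q (fun x => ψ i x * ψ j x * x ^ (2 * v + 1)) =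
        if i = j then 1 else 0) := by
  open QProlate in
  obtain ⟨N, rfl⟩ := ha
  obtain ⟨f, U, hiso, hf, hUf, heig, hf0, hlam, horth⟩ := hu.exists_sqSummable hq0 hq1 hv
  have hq : 0 < 1 - q := sub_pos.2 hq1
  have hff : ∀ i, 0 < inner ℝ (f i) (f i) := fun i => real_inner_self_pos.2 (hf0 i)
  have hext : ∀ i n, latticeSeq q v (extension q v (q ^ N) (lam i) (u i)) n =
      1 / lam i * U (f i) n := fun i n => by
    rw [hUf, latticeSeq, latticeSeq, extension]
    ring
  obtain ⟨c, hc⟩ : ∃ c : ℕ → ℝ, ∀ i, norm2 q v (extension q v (q ^ N) (lam i) (u i)) = c i :=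
    ⟨_, fun _ => rfl⟩
  -- The isometry evaluates the norm over the whole lattice in terms of the cut-off `f i` alone.
  have hcsq : ∀ i, 0 < c i ∧
      c i ^ 2 = (1 - q) * (1 / lam i * (1 / lam i) * inner ℝ (f i) (f i)) := fun i => by
    have h1 := hasSum_mul_of_eq_const_mul (hext i) (hext i)
    rw [hiso] at h1
    have h3 := (jacksonTopIntegrable_and_jacksonTop_eq hq0 h1).2
    have h4 : 0 < (1 - q) * (1 / lam i * (1 / lam i) * inner ℝ (f i) (f i)) :=
      mul_pos hq (mul_pos (mul_self_pos.2 (one_div_ne_zero (hlam i))) (hff i))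
    have h5 : c i = √((1 - q) * (1 / lam i * (1 / lam i) * inner ℝ (f i) (f i))) := by
      rw [← hc, norm2, ← h3]
      simp only [sq, abs_mul_abs_self]
    rw [h5]
    exact ⟨Real.sqrt_pos.2 h4, Real.sq_sqrt h4.le⟩
  have hψn : ∀ i n, latticeSeq q v (ψ i) n = 1 / (lam i * c i) * U (f i) n := fun i n => by
    have h1 := hext i n
    have h2 := (hcsq i).1.ne'
    rw [latticeSeq] at h1 ⊢
    rw [hψ, prolate, mul_div_assoc', h1, hc]
    field_simp
  -- On the interval the eigenvalue equation cancels the `1 / lam i` of the extension, which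
  -- accounts for the factor `lam i * lam j` between the two integrals.
  have hψN : ∀ i n, intervalSeq q v N (ψ i) n = 1 / c i * f i n := fun i n => by
    have h2 := (hcsq i).1.ne'
    have h3 := hlam i
    rw [intervalSeq]
    split_ifs with hn
    · rw [hψn, heig i n hn]
      field_simp
    · rw [hf, intervalSeq, if_neg hn, mul_zero]
  have hi := (hcsq i).1.ne'
  have hli := hlam i
  have hcs := (hcsq i).2
  have hA := hasSum_mul_of_eq_const_mul (hψN i) (hψN j)
  have hB := hasSum_mul_of_eq_const_mul (hψn i) (hψn j)
  rw [hiso] at hB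
  obtain ⟨hA1, hA2⟩ := jacksonIntegrable_and_jackson_eq hq0 hA
  obtain ⟨hB1, hB2⟩ := jacksonTopIntegrable_and_jacksonTop_eq hq0 hB
  refine ⟨⟨hA1, ?_⟩, hB1, ?_⟩
  · rw [hA2]
    split_ifs with hij
    · subst hij
      field_simp at hcs ⊢
      linear_combination -hcs
    · rw [horth i j hij]
      ring
  · rw [hB2]
    split_ifs with hij
    · subst hij
      field_simp at hcs ⊢
      linear_combination -hcs
    · rw [horth i j hij]
      ring
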